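/- Let $H=(p_k)_{k\ge1}$ be a scale, i.e. a strictly increasing sequence of positive integers with $p_k\mid p_{k+1}$ for all $k$, and suppose $p_1\ge 3$. Let $G=\varprojlim_k \mathbb Z/p_k\mathbb Z$ be the adding machine with scale $H$, $\lambda$ its normalized Haar measure and $\tau(g)=g+\mathbf 1$, $\mathbf 1=(1,1,1,\dots)$, the odometer map on $G$. For a one-sided sequence $y=(y_k)_{k\ge1}$ define the associated one-sided Toeplitz sequence $x_y=(x_y(n))_{n\ge1}$ by successively filling in positions: in step $k=1,2,\dots$ the symbol $y_k$ is placed at the first position left unoccupied by steps $1,\dots,k-1$, and is repeated from there periodically with period $p_k$ (every position is occupied in exactly one step). Then there exists a one-sided sequence $y\in\{0,1\}^{\mathbb N}$ such that 1. the orbit closure $Y$ of $y$ under the shift has positive topological entropy and supports uncountably many ergodic shift-invariant probability measures; 2. nevertheless, the associated Toeplitz subshift $X_y$ (the orbit closure of $x_y$ under the shift) is strictly ergodic (minimal and uniquely ergodic), has topological entropy zero, and, with its unique invariant probability measure, is measure-theoretically isomorphic to the odometer $(G,\lambda,\tau)$. Assertion 2 holds, for the same $y$, both for the unilateral subshift (the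 closure in $\{0,1\}^{\mathbb N}$ of the forward shift orbit of $x_y$) and for the bilateral one (all $z\in\{0,1\}^{\mathbb Z}$ each of whose finite blocks occurs in $x_y$). In particular, positive entropy of the orbit closure of $y$ does not automatically pass to that of $x_y$. -/

import Mathlib

open MeasureTheory SymbolicDynamics.FullShift

noncomputable section

/-! ### Scales and odometers -/

/-- A scale: a (strictly) increasing sequence of positive integers, each dividing the next.
The sequence `p_1, p_2, …` is indexed from zero: `H.p k` is `p_{k+1}`. -/
structure Scale where
  p : ℕ → ℕ
  pos : ∀ k, 0 < p k
  strictMono : StrictMono p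
  dvd : ∀ k, p k ∣ p (k + 1)

namespace Scale

variable (H : Scale)

instance (k : ℕ) : NeZero (H.p k) := ⟨(H.pos k).ne'⟩

/-- The adding machine with scale `H`: the inverse limit of the groups `ℤ / p_k ℤ`, as a subgroup
of their product. It carries the topology and the Borel sets induced from the product of the
discrete groups `ℤ / p_k ℤ`. -/
def addingMachine : AddSubgroup (∀ k, ZMod (H.p k)) where
  carrier := {g | ∀ k, ZMod.castHom (H.dvd k) (ZMod (H.p k)) (g (k + 1)) = g k}
  zero_mem' := fun k => by simp only [Pi.zero_apply, map_zero]
  add_mem' := fun {a b} ha hb k => by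
    simp only [Pi.add_apply, map_add, ha k, hb k]
  neg_mem' := fun {a} ha k => by
    simp only [Pi.neg_apply, map_neg, ha k]

lemma isClosed_addingMachine : IsClosed (H.addingMachine : Set (∀ k, ZMod (H.p k))) := by
  have h : (H.addingMachine : Set (∀ k, ZMod (H.p k))) =
      ⋂ k, {g | ZMod.castHom (H.dvd k) (ZMod (H.p k)) (g (k + 1)) = g k} := by
    ext g
    simp only [Set.mem_iInter]
    exact Iff.rfl
  rw [h]
  exact isClosed_iInter fun k => isClosed_eq
    (continuous_of_discreteTopology.comp (continuous_apply (k + 1))) (continuous_apply k)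

instance : CompactSpace H.addingMachine :=
  isCompact_iff_compactSpace.mp H.isClosed_addingMachine.isCompact

/-- The topological generator `(1, 1, 1, …)` of the adding machine. -/
def generator : H.addingMachine :=
  ⟨fun _ => 1, fun k => map_one (ZMod.castHom (H.dvd k) (ZMod (H.p k)))⟩

/-- The odometer map `τ(g) = g + (1, 1, 1, …)`. -/
def tau (g : H.addingMachine) : H.addingMachine := g + H.generator

/-- The normalized Haar measure of the adding machine. -/
def haar : Measure H.addingMachine := Measure.addHaarMeasure ⊤

/-! ### The Toeplitz sequence associated with a sequence

Positions `n = 1, 2, …` and steps `k = 1, 2, …` are both indexed from zero. -/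

/-- The set of positions occupied after the first `k` steps. In each step the first position still
available is filled, and then all positions (to the right) congruent to it modulo the period of
that step. -/
def occupied : ℕ → Set ℕ
  | 0 => ∅
  | k + 1 => occupied k ∪ {n | n ≡ sInf (occupied k)ᶜ [MOD H.p k]}

/-- The step in which the position `n` gets occupied. -/
def step (n : ℕ) : ℕ := sInf {k | n ∈ H.occupied (k + 1)}

/-- The associated sequence `x_y`: the symbol `y_k` stands on all positions filled in step `k`. -/
def toeplitz {Λ : Type*} (y : ℕ → Λ) (n : ℕ) : Λ := y (H.step n)

end Scale

/-! ### Orbit closures -/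

/-- The (unilateral) orbit closure of a one-sided sequence under the shift. -/
def orbitClosure {Λ : Type*} [TopologicalSpace Λ] (x : ℕ → Λ) : Set (ℕ → Λ) :=
  closure (Set.range fun n : ℕ => shift n x)

/-- The bilateral subshift generated by a one-sided sequence `x`: all two-sided sequences each of
whose finite blocks occurs in `x`. -/
def bilateralSubshift {Λ : Type*} (x : ℕ → Λ) : Set (ℤ → Λ) :=
  {z | ∀ (a : ℤ) (n : ℕ), ∃ j : ℕ, ∀ i < n, z (a + i) = x (j + i)}

/-! ### Dynamics of a map `T` on a subset `X` of the ambient space -/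

/-- `μ` is a `T`-invariant probability measure supported by `X`. -/
def IsInvariantProb {α : Type*} [MeasurableSpace α] (T : α → α) (X : Set α) (μ : Measure α) :
    Prop :=
  IsProbabilityMeasure μ ∧ MeasurePreserving T μ μ ∧ μ Xᶜ = 0

/-- `(X, T)` is minimal: `X` is nonempty, closed, invariant, and every orbit in `X` is dense. -/
def IsMinimalSystem {α : Type*} [TopologicalSpace α] (T : α → α) (X : Set α) : Prop :=
  X.Nonempty ∧ IsClosed X ∧ Set.MapsTo T X X ∧
    ∀ x ∈ X, X ⊆ closure (Set.range fun n : ℕ => T^[n] x)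

/-- `(X, T)` is strictly ergodic: minimal and uniquely ergodic. -/
def IsStrictlyErgodic {α : Type*} [TopologicalSpace α] [MeasurableSpace α] (T : α → α)
    (X : Set α) : Prop :=
  IsMinimalSystem T X ∧ ∃! μ : Measure α, IsInvariantProb T X μ

/-- Measure-theoretic isomorphism of `(α, μ, T)` and `(β, ν, S)`: measure-preserving maps in both
directions, inverse to each other and equivariant up to null sets. -/
def MeasureIsomorphic {α β : Type*} [MeasurableSpace α] [MeasurableSpace β] (T : α → α)
    (μ : Measure α) (S : β → β) (ν : Measure β) : Prop :=
  ∃ (φ : α → β) (ψ : β → α), MeasurePreserving φ μ ν ∧ MeasurePreserving ψ ν μ ∧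
    (∀ᵐ a ∂μ, ψ (φ a) = a) ∧ (∀ᵐ b ∂ν, φ (ψ b) = b) ∧ (∀ᵐ a ∂μ, φ (T a) = S (φ a))

end

/-!
The sequence `y` is built so that it contains all finite words, although `x_y` is a regular Toeplitz
sequence.

Let `firstFree k` be the first position that is filled in step `k`. As `3 ≤ H.p 0`, the class
modulo `H.p k` filled in this step is never that of `-1` or `-2`, and this makes the following
possible (`Scale.exists_run`): for every `J` there are arbitrarily long runs of consecutive steps in
which only positions congruent to `-1` modulo `H.p J` are filled. Indeed, suppose that such a run fills positions in `[0, P)`, where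
`P = H.p k`. The last position `P - 1` of this block is filled in some later step `K`, and the steps
after `K` fill the next block `[P, 2P)` in the way in which the first one was filled from step
`k + 1` on (`Scale.firstFree_translate`); so the run, moved by `P`, occurs again, one step longer.
Now write the `n`-th finite word into a run which belongs to `J = n`, and let `y` be `false` elsewhere
(`Scale.Admissible`). Every word occurs in `y`, so its orbit closure is the full shift, which has
positive entropy (`coverEntropy_fullShift_pos`) and uncountably many ergodic measures
(`not_countable_ergodic_measures`, by coding the doubling map of the circle). On the other hand, for
each `J`, all but finitely many steps with symbol `true` only affect the class of `-1` modulo `H.p J`,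
so `x_y` is periodic off this class (`Scale.Admissible.exists_toeplitz_eq`), whose density
`1 / H.p J` tends to zero.

Accordingly, `x_y` is read along the orbit of `0` by a function on the adding machine which is
continuous except at the point `-(1, 1, …)` (`Scale.symbol`). The map `Scale.coding`, which takes a
point to its itinerary, is injective (`Scale.Admissible.eq_of_symbol_eq`) and takes values in the
subshift, hence it is a measurable embedding which turns Haar measure into an invariant measure and
the odometer into the shift. Since `x_y` agrees with periodic sequences up to small density, this
is the only invariant measure (`Scale.Admissible.measure_eq`), and the entropy is zero
(`Scale.Admissible.coverEntropy_eq_zero`). Minimality holds for all Toeplitz sequences. The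
unilateral and the bilateral subshift are treated together, over an index set `Γ` which is `ℕ` or `ℤ`.
-/

open scoped Topology Uniformity

namespace Scale

variable (H : Scale)

/-! ### The filling procedure -/

/-- The first position that is still free after `k` steps; it gets filled in the next step,
together with all positions congruent to it modulo `H.p k`. -/
noncomputable def firstFree (k : ℕ) : ℕ := sInf (H.occupied k)ᶜ

lemma p_dvd_p {j k : ℕ} (h : j ≤ k) : H.p j ∣ H.p k := by
  induction h with
  | refl => exact dvd_rfl
  | step _ ih => exact ih.trans (H.dvd _)

lemma two_mul_p_le {j k : ℕ} (h : j < k) : 2 * H.p j ≤ H.p k := by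
  obtain ⟨c, hc⟩ := H.p_dvd_p h.le
  have h1 := H.strictMono h
  rcases c with _ | _ | c
  · have := H.pos k
    omega
  · omega
  · rw [hc]
    nlinarith [H.pos j]

lemma lt_p (k : ℕ) : k < H.p k := by
  induction k with
  | zero => exact H.pos 0
  | succ k ih => exact (Nat.succ_le_of_lt ih).trans_lt (H.strictMono k.lt_succ_self)

lemma mem_occupied {k n : ℕ} :
    n ∈ H.occupied k ↔ ∃ j < k, n ≡ H.firstFree j [MOD H.p j] := by
  induction k with
  | zero => simp [occupied]
  | succ k ih =>
    simp only [occupied, Set.mem_union, ih, Set.mem_ofPred_eq, Nat.lt_succ_iff_lt_or_eq]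
    constructor
    · rintro (⟨j, hj, h⟩ | h)
      exacts [⟨j, .inl hj, h⟩, ⟨k, .inr rfl, h⟩]
    · rintro ⟨j, hj | rfl, h⟩
      exacts [.inl ⟨j, hj, h⟩, .inr h]

lemma occupied_mono {j k : ℕ} (h : j ≤ k) : H.occupied j ⊆ H.occupied k := fun n hn => by
  rw [mem_occupied] at hn ⊢
  obtain ⟨i, hi, hn⟩ := hn
  exact ⟨i, hi.trans_le h, hn⟩

/-- The occupied set after `k + 1` steps has period `H.p k`. -/
lemma mem_occupied_congr {k n n' : ℕ} (h : n ≡ n' [MOD H.p k]) :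
    n ∈ H.occupied (k + 1) ↔ n' ∈ H.occupied (k + 1) := by
  simp only [mem_occupied]
  refine exists_congr fun j => and_congr_right fun hj => ?_
  have hd : n ≡ n' [MOD H.p j] := h.of_dvd (H.p_dvd_p (by omega))
  exact ⟨hd.symm.trans, hd.trans⟩

variable {H}

lemma not_modEq_of_dvd_add {j n i m : ℕ} (hi : 0 < i) (hm : m + i < H.p j) (hn : H.p j ∣ n + i) :
    ¬ n ≡ m [MOD H.p j] := fun h => by
  have h1 : m + i ≡ 0 [MOD H.p j] :=
    (h.add_right i).symm.trans ((Nat.modEq_zero_iff_dvd).2 hn)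
  have := Nat.le_of_dvd (by omega) ((Nat.modEq_zero_iff_dvd).1 h1)
  omega

/-- The class modulo `H.p k` filled in step `k` is never that of `-1` or `-2`; this is where
`3 ≤ H.p 0` enters. -/
lemma firstFree_add_two_lt (hH : 3 ≤ H.p 0) (k : ℕ) : H.firstFree k + 2 < H.p k := by
  induction k using Nat.strong_induction_on with
  | _ k ih =>
    rcases k with _ | k
    · have : H.firstFree 0 ≤ 0 := Nat.sInf_le (by simp [occupied])
      omega
    · have h3 : 3 ≤ H.p k := hH.trans (H.strictMono.monotone k.zero_le)
      have : H.firstFree (k + 1) ≤ H.p k - 2 := by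
        refine Nat.sInf_le fun hmem => ?_
        obtain ⟨j, hj, h⟩ := H.mem_occupied.1 hmem
        refine not_modEq_of_dvd_add two_pos (ih j hj) ?_ h
        rw [Nat.sub_add_cancel (by omega)]
        exact H.p_dvd_p (by omega)
      have := H.two_mul_p_le (Nat.lt_add_one k)
      omega

lemma not_modEq_firstFree (hH : 3 ≤ H.p 0) {j n i : ℕ} (hi : 0 < i) (hi2 : i ≤ 2)
    (hn : H.p j ∣ n + i) : ¬ n ≡ H.firstFree j [MOD H.p j] :=
  not_modEq_of_dvd_add hi (by have := firstFree_add_two_lt hH j; omega) hn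

lemma not_mem_occupied_of_dvd_add (hH : 3 ≤ H.p 0) {k n i : ℕ} (hi : 0 < i) (hi2 : i ≤ 2)
    (hn : H.p k ∣ n + i) : n ∉ H.occupied (k + 1) := fun h => by
  obtain ⟨j, hj, h⟩ := H.mem_occupied.1 h
  exact not_modEq_firstFree hH hi hi2 ((H.p_dvd_p (by omega)).trans hn) h

lemma firstFree_not_mem (hH : 3 ≤ H.p 0) (k : ℕ) : H.firstFree k ∉ H.occupied k := by
  refine Nat.sInf_mem (s := (H.occupied k)ᶜ) ⟨H.p k - 1, fun h => ?_⟩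
  refine not_mem_occupied_of_dvd_add hH (i := 1) one_pos one_le_two (k := k) ?_
    (H.occupied_mono k.le_succ h)
  rw [Nat.sub_add_cancel (show 1 ≤ H.p k from H.pos k)]

lemma mem_occupied_of_lt {k n : ℕ} (h : n < H.firstFree k) : n ∈ H.occupied k := by
  by_contra hn
  exact absurd (Nat.sInf_le (s := (H.occupied k)ᶜ) hn) (not_le.2 h)

lemma firstFree_le {k n : ℕ} (h : n ∉ H.occupied k) : H.firstFree k ≤ n :=
  Nat.sInf_le (s := (H.occupied k)ᶜ) h

lemma firstFree_strictMono (hH : 3 ≤ H.p 0) : StrictMono H.firstFree := by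
  refine strictMono_nat_of_lt_succ fun k => ?_
  have h1 := firstFree_not_mem hH (k + 1)
  refine lt_of_le_of_ne (firstFree_le fun h => h1 (H.occupied_mono k.le_succ h)) fun h => h1 ?_
  rw [← h]
  exact H.mem_occupied.2 ⟨k, k.lt_succ_self, rfl⟩

/-- Classes filled in different steps are disjoint. -/
lemma eq_of_modEq_firstFree (hH : 3 ≤ H.p 0) {j k n : ℕ} (hj : n ≡ H.firstFree j [MOD H.p j])
    (hk : n ≡ H.firstFree k [MOD H.p k]) : j = k := by
  wlog h : j < k generalizing j k
  · rcases (not_lt.1 h).lt_or_eq with h | h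
    exacts [(this hk hj h).symm, h.symm]
  exact (firstFree_not_mem hH k
    (H.mem_occupied.2 ⟨j, h, (hk.of_dvd (H.p_dvd_p h.le)).symm.trans hj⟩)).elim

lemma exists_modEq_firstFree (hH : 3 ≤ H.p 0) (n : ℕ) :
    ∃ k, n ≡ H.firstFree k [MOD H.p k] := by
  by_contra! h
  have h1 : H.firstFree (n + 1) ≤ n := firstFree_le fun hn => by
    obtain ⟨j, -, hj⟩ := H.mem_occupied.1 hn
    exact h j hj
  have := (firstFree_strictMono hH).id_le (n + 1)
  simp only [id] at this
  omega

lemma step_eq_iff (hH : 3 ≤ H.p 0) {n k : ℕ} :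
    H.step n = k ↔ n ≡ H.firstFree k [MOD H.p k] := by
  have key : n ≡ H.firstFree (H.step n) [MOD H.p (H.step n)] := by
    obtain ⟨k, hk⟩ := exists_modEq_firstFree hH n
    have hmem : n ∈ H.occupied (H.step n + 1) :=
      Nat.sInf_mem (s := {k | n ∈ H.occupied (k + 1)})
        ⟨k, H.mem_occupied.2 ⟨k, k.lt_succ_self, hk⟩⟩
    obtain ⟨j, hj, hn⟩ := H.mem_occupied.1 hmem
    have : H.step n ≤ j := Nat.sInf_le (s := {k | n ∈ H.occupied (k + 1)})
      (H.mem_occupied.2 ⟨j, j.lt_succ_self, hn⟩)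
    rwa [show H.step n = j by omega]
  exact ⟨fun h => h ▸ key, fun h => eq_of_modEq_firstFree hH key h⟩

lemma modEq_firstFree_step (hH : 3 ≤ H.p 0) (n : ℕ) :
    n ≡ H.firstFree (H.step n) [MOD H.p (H.step n)] :=
  (step_eq_iff hH).1 rfl

lemma step_firstFree (hH : 3 ≤ H.p 0) (k : ℕ) : H.step (H.firstFree k) = k :=
  (step_eq_iff hH).2 rfl

lemma toeplitz_firstFree (hH : 3 ≤ H.p 0) {Λ : Type*} (y : ℕ → Λ) (k : ℕ) :
    H.toeplitz y (H.firstFree k) = y k := by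
  rw [toeplitz, step_firstFree hH]

lemma toeplitz_eq (hH : 3 ≤ H.p 0) {Λ : Type*} (y : ℕ → Λ) {n k : ℕ}
    (h : n ≡ H.firstFree k [MOD H.p k]) : H.toeplitz y n = y k := by
  rw [toeplitz, (step_eq_iff hH).2 h]

/-- A residue class that is free at some step keeps free positions forever. -/
lemma exists_modEq_not_mem_occupied {a i : ℕ} (ha : a ∉ H.occupied (i + 1)) {k : ℕ}
    (hk : i ≤ k) : ∃ n, n ≡ a [MOD H.p i] ∧ n ∉ H.occupied (k + 1) := by
  induction k, hk using Nat.le_induction with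
  | base => exact ⟨a, rfl, ha⟩
  | succ k hk ih =>
    obtain ⟨n, hn, hfree⟩ := ih
    have hstep (n' : ℕ) (h' : n' ∉ H.occupied (k + 1)) :
        n' ∉ H.occupied (k + 1 + 1) ∨ n' ≡ H.firstFree (k + 1) [MOD H.p (k + 1)] := by
      by_contra! h
      obtain ⟨j, hj, hjn⟩ := H.mem_occupied.1 h.1
      rcases Nat.lt_succ_iff_lt_or_eq.1 hj with hj | rfl
      exacts [h' (H.mem_occupied.2 ⟨j, hj, hjn⟩), h.2 hjn]
    have hper : n + H.p k ≡ n [MOD H.p k] := by simp [Nat.ModEq]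
    rcases hstep n hfree with h | h
    · exact ⟨n, hn, h⟩
    rcases hstep (n + H.p k) (fun h => hfree ((H.mem_occupied_congr hper).1 h)) with h' | h'
    · exact ⟨n + H.p k, (hper.of_dvd (H.p_dvd_p hk)).trans hn, h'⟩
    · have h0 : n + H.p k ≡ n + 0 [MOD H.p (k + 1)] := h'.trans h.symm
      have := Nat.le_of_dvd (H.pos k)
        ((Nat.modEq_zero_iff_dvd).1 (Nat.ModEq.add_left_cancel' n h0))
      have := H.strictMono (Nat.lt_add_one k)
      omega

/-! ### Long runs of steps that fill positions congruent to `-1` -/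

/-- Suppose that all positions before `P = H.p k` are filled at step `K`, and that the block
`[P, 2P)` is then still in the state which `[0, P)` had at step `k + 1`. Then the following steps
fill `[P, 2P)` in the way in which `[0, P)` was filled from step `k + 1` on. -/
lemma firstFree_translate (hH : 3 ≤ H.p 0) {k K : ℕ} (hK : k < K)
    (hlow : ∀ n < H.p k, n ∈ H.occupied K)
    (hblock : ∀ n < H.p k, H.p k + n ∈ H.occupied K ↔ n ∈ H.occupied (k + 1)) (l : ℕ)
    (hl : ∀ t < l, H.firstFree (k + 1 + t) < H.p k) :
    ∀ t < l, H.firstFree (K + t) = H.p k + H.firstFree (k + 1 + t) := by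
  have hmin (t : ℕ) (ht : t < l)
      (key : ∀ n < H.p k, H.p k + n ∈ H.occupied (K + t) ↔ n ∈ H.occupied (k + 1 + t)) :
      H.firstFree (K + t) = H.p k + H.firstFree (k + 1 + t) := by
    have hle : H.firstFree (K + t) ≤ H.p k + H.firstFree (k + 1 + t) :=
      firstFree_le fun h => firstFree_not_mem hH _ ((key _ (hl t ht)).1 h)
    have hfree := firstFree_not_mem hH (K + t)
    have hge : H.p k ≤ H.firstFree (K + t) := by
      by_contra! h
      exact hfree (H.occupied_mono (Nat.le_add_right K t) (hlow _ h))
    obtain ⟨r, hr⟩ := Nat.exists_eq_add_of_le hge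
    have hlt := hl t ht
    rw [hr] at hfree hle ⊢
    have : H.firstFree (k + 1 + t) ≤ r :=
      firstFree_le fun h => hfree ((key r (by omega)).2 h)
    omega
  have key : ∀ t ≤ l,
      ∀ n < H.p k, H.p k + n ∈ H.occupied (K + t) ↔ n ∈ H.occupied (k + 1 + t) := by
    intro t
    induction t with
    | zero => exact fun _ => hblock
    | succ t ih =>
      intro ht n hn
      have ih := ih (by omega)
      have hm := hl t ht
      have h1 : 2 * H.p k ≤ H.p (K + t) := H.two_mul_p_le (by omega)
      have h2 : 2 * H.p k ≤ H.p (k + 1 + t) := H.two_mul_p_le (by omega)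
      change (_ ∈ H.occupied (K + t) ∨ _ ≡ H.firstFree (K + t) [MOD H.p (K + t)]) ↔
        (_ ∈ H.occupied (k + 1 + t) ∨ _ ≡ H.firstFree (k + 1 + t) [MOD H.p (k + 1 + t)])
      rw [ih n hn, hmin t ht ih]
      refine or_congr_right ?_
      constructor
      · intro h
        have := h.eq_of_lt_of_lt (by omega) (by omega)
        rw [show n = H.firstFree (k + 1 + t) by omega]
      · intro h
        rw [h.eq_of_lt_of_lt (by omega) (by omega)]
  exact fun t ht => hmin t ht (key t ht.le)

/-- For every `J` there are arbitrarily long runs of consecutive steps, arbitrarily far out, in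
which only positions congruent to `-1` modulo `H.p J` are filled. A run of length `l` filling
positions in `[0, H.p k)` is extended as follows: the last position `H.p k - 1` of that block is
filled in some step `K`; the steps after `K` refill the next block in the way in which the first
one was filled from step `k + 1` on. -/
lemma exists_run (hH : 3 ≤ H.p 0) (J l N : ℕ) :
    ∃ K, N ≤ K ∧ ∀ t < l, H.p J ∣ H.firstFree (K + t) + 1 := by
  suffices h : ∀ N, J ≤ N → ∃ k, N ≤ k ∧
      ∀ t < l, H.firstFree (k + 1 + t) < H.p k ∧ H.p J ∣ H.firstFree (k + 1 + t) + 1 by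
    obtain ⟨k, hk, h⟩ := h (max J N) (le_max_left _ _)
    exact ⟨k + 1, by omega, fun t ht => (h t ht).2⟩
  induction l with
  | zero => exact fun N _ => ⟨N, le_rfl, fun t ht => by omega⟩
  | succ l ih =>
    intro N hN
    obtain ⟨k, hk, hrun⟩ := ih N hN
    have hpos := H.pos k
    have h3 : 3 ≤ H.p k := hH.trans (H.strictMono.monotone k.zero_le)
    have hJ : H.p J ∣ H.p k := H.p_dvd_p (hN.trans hk)
    have hcancel : H.p k - 1 + 1 = H.p k := Nat.sub_add_cancel hpos
    obtain ⟨K, hK⟩ := exists_modEq_firstFree hH (H.p k - 1)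
    have hkK : k < K := by
      by_contra! h
      refine not_modEq_firstFree hH (i := 1) one_pos one_le_two ?_ hK
      rw [hcancel]
      exact H.p_dvd_p h
    have hPK := H.two_mul_p_le hkK
    have hKP : H.firstFree K = H.p k - 1 :=
      (hK.eq_of_lt_of_lt (by omega) (by have := firstFree_add_two_lt hH K; omega)).symm
    -- The position `H.p k - 2` is free at step `k + 1`, so `H.p k - 1` is filled later than that.
    have hkK' : k + 1 < K := by
      refine lt_of_le_of_ne hkK fun h => ?_
      have : H.firstFree (k + 1) ≤ H.p k - 2 := firstFree_le
        (not_mem_occupied_of_dvd_add hH (i := 2) two_pos le_rfl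
          (by rw [Nat.sub_add_cancel (by omega)]))
      rw [h] at this
      omega
    have htrans := firstFree_translate hH (k := k) (K := K + 1) (by omega) (fun n hn => ?_)
      (fun n hn => ?_) l (fun t ht => (hrun t ht).1)
    · refine ⟨K - 1, by omega, fun t ht => ?_⟩
      rw [Nat.sub_add_cancel (by omega)]
      have hPK' : 2 * H.p k ≤ H.p (K - 1) := H.two_mul_p_le (by omega)
      rcases t with _ | t
      · rw [add_zero, hKP, hcancel]
        exact ⟨by omega, hJ⟩
      · have ht : t < l := by omega
        rw [show K + (t + 1) = K + 1 + t by ring, htrans t ht, add_assoc (H.p k)]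
        exact ⟨by have := (hrun t ht).1; omega, hJ.add (hrun t ht).2⟩
    · refine mem_occupied_of_lt (lt_of_le_of_lt ?_ (firstFree_strictMono hH K.lt_add_one))
      omega
    · have hper : H.p k + n ≡ n [MOD H.p k] := by simp [Nat.ModEq]
      rw [← H.mem_occupied_congr hper]
      refine ⟨fun h => ?_, fun h => H.occupied_mono (by omega) h⟩
      obtain ⟨j, hj, hjn⟩ := H.mem_occupied.1 h
      refine H.mem_occupied.2 ⟨j, ?_, hjn⟩
      by_contra! hkj
      have hPj : 2 * H.p k ≤ H.p j := H.two_mul_p_le (by omega)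
      have hjK := (firstFree_strictMono hH).monotone (show j ≤ K by omega)
      have := hjn.eq_of_lt_of_lt (by omega) (by omega)
      omega

end Scale

/-! ### The sequence `y` -/

lemma exists_indicator {α : Type*} (p : α → Prop) : ∃ f : α → Bool, ∀ a, f a = true ↔ p a := by
  classical
  exact ⟨fun a => decide (p a), fun a => decide_eq_true_iff⟩

/-- Given properties `Q 0, Q 1, …` of natural numbers, each implied by the next one and each
holding on arbitrarily long intervals arbitrarily far out, all finite words can be written into
such intervals: the `n`-th word into an interval where `Q n` holds. An additional `false` is put in
front of each word. -/
lemma exists_sequence_of_runs (Q : ℕ → ℕ → Prop) (hQ : ∀ i j k, i ≤ j → Q j k → Q i k)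
    (hrun : ∀ j l N, ∃ K, N ≤ K ∧ ∀ t < l, Q j (K + t)) :
    ∃ y : ℕ → Bool, (∀ w : List Bool, ∃ a, ∀ i (hi : i < w.length), y (a + i) = w[i]) ∧
      (∀ j, ∃ N, ∀ k, N ≤ k → y k = true → Q j k) ∧ ∀ j, ∃ k, j ≤ k ∧ y k = false ∧ Q j k := by
  obtain ⟨e, he⟩ := exists_surjective_nat (List Bool)
  choose κ hκN hκ using hrun
  let w : ℕ → List Bool := fun n => false :: e n
  let K : ℕ → ℕ := fun n => Nat.rec (κ 0 (w 0).length 0)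
    (fun n a => κ (n + 1) (w (n + 1)).length (a + (w n).length)) n
  have hKsucc (n) : K n + (w n).length ≤ K (n + 1) := hκN (n + 1) _ _
  have hKQ (n) : ∀ t < (w n).length, Q n (K n + t) := by
    cases n with
    | zero => exact hκ 0 _ _
    | succ n => exact hκ (n + 1) _ _
  have hwpos (n) : 0 < (w n).length := by simp [w]
  have hKmono : StrictMono K := strictMono_nat_of_lt_succ fun n => by
    have := hKsucc n
    have := hwpos n
    omega
  have hKlt {m n} (h : m < n) : K m + (w m).length ≤ K n := (hKsucc m).trans (hKmono.monotone h)
  obtain ⟨y, hy⟩ : ∃ y : ℕ → Bool, ∀ k, y k = true ↔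
      ∃ n, K n ≤ k ∧ (w n)[k - K n]? = some true :=
    exists_indicator fun k => ∃ n, K n ≤ k ∧ (w n)[k - K n]? = some true
  have hyw (n t) (ht : t < (w n).length) : y (K n + t) = (w n)[t] := by
    rw [Bool.eq_iff_iff, hy]
    constructor
    · rintro ⟨m, hm, h⟩
      obtain ⟨hlen, h'⟩ := List.getElem?_eq_some_iff.1 h
      have hmn : m = n := by
        rcases lt_trichotomy m n with h | h | h
        · have := hKlt h
          omega
        · exact h
        · have := hKlt h
          omega
      subst hmn
      simpa using h'
    · intro h
      refine ⟨n, by omega, ?_⟩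
      rw [List.getElem?_eq_some_iff]
      exact ⟨by omega, by simpa using h⟩
  refine ⟨y, fun v => ?_, fun j => ⟨K j, fun k hk h => ?_⟩, fun j => ⟨K j, hKmono.id_le j, ?_, ?_⟩⟩
  · obtain ⟨n, rfl⟩ := he v
    refine ⟨K n + 1, fun i hi => ?_⟩
    rw [add_assoc, add_comm 1, hyw n (i + 1) (by simpa [w] using hi)]
    simp [w]
  · obtain ⟨n, hn, hnk⟩ := (hy k).1 h
    obtain ⟨hlen, -⟩ := List.getElem?_eq_some_iff.1 hnk
    have hjn : j ≤ n := by
      by_contra! hlt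
      have := hKlt hlt
      omega
    have := hKQ n _ hlen
    rw [Nat.add_sub_cancel' hn] at this
    exact hQ j n k hjn this
  · simpa [w] using hyw j 0 (hwpos j)
  · simpa using hKQ j 0 (hwpos j)

namespace Scale

/-- The properties of `y` on which the proof rests: all words occur in `y`, but for each `J`
all except finitely many steps with symbol `true` fill positions congruent to `-1` modulo `H.p J`;
among the steps which do so, there are also some with symbol `false`. -/
structure Admissible (H : Scale) (y : ℕ → Bool) : Prop where
  exists_word (w : List Bool) : ∃ a, ∀ i (hi : i < w.length), y (a + i) = w[i]
  dvd_of_true (J : ℕ) : ∃ N, ∀ k, N ≤ k → y k = true → H.p J ∣ H.firstFree k + 1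
  exists_false (J : ℕ) : ∃ k, J ≤ k ∧ y k = false ∧ H.p J ∣ H.firstFree k + 1

variable {H : Scale}

lemma exists_admissible (hH : 3 ≤ H.p 0) : ∃ y, H.Admissible y := by
  obtain ⟨y, h1, h2, h3⟩ := exists_sequence_of_runs (fun J k => H.p J ∣ H.firstFree k + 1)
    (fun i j k hij h => (H.p_dvd_p hij).trans h) (exists_run hH)
  exact ⟨y, h1, h2, h3⟩

namespace Admissible

variable {y : ℕ → Bool}

lemma exists_true (hy : H.Admissible y) (N : ℕ) : ∃ k, N ≤ k ∧ y k = true := by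
  obtain ⟨a, ha⟩ := hy.exists_word (List.replicate (N + 1) true)
  exact ⟨a + N, by omega, by simpa using ha N (by simp)⟩

lemma orbitClosure_eq_univ (hy : H.Admissible y) : orbitClosure y = Set.univ := by
  refine Set.eq_univ_of_forall fun z => ?_
  rw [orbitClosure, mem_closure_iff_nhds]
  intro s hs
  rw [nhds_pi, Filter.mem_pi] at hs
  obtain ⟨I, hI, t, ht, hts⟩ := hs
  obtain ⟨n, hn⟩ := hI.bddAbove
  obtain ⟨a, ha⟩ := hy.exists_word (List.ofFn fun i : Fin (n + 1) => z i)
  refine ⟨shift a y, hts fun i hi => ?_, a, rfl⟩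
  have := ha i (by simpa using Nat.lt_succ_of_le (hn hi))
  rw [shift_apply, this, List.getElem_ofFn]
  exact mem_of_mem_nhds (ht i)

end Admissible

/-- Every word of a Toeplitz sequence recurs with a period. -/
lemma exists_recurrence (hH : 3 ≤ H.p 0) {Λ : Type*} (y : ℕ → Λ) (j n : ℕ) :
    ∃ P, 0 < P ∧ ∀ j', j' ≡ j [MOD P] → ∀ i < n, H.toeplitz y (j' + i) = H.toeplitz y (j + i) := by
  let N := (Finset.range n).sup fun i => H.step (j + i)
  refine ⟨H.p N, H.pos N, fun j' hj' i hi => ?_⟩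
  have hN : H.step (j + i) ≤ N :=
    Finset.le_sup (f := fun i => H.step (j + i)) (Finset.mem_range.2 hi)
  rw [toeplitz_eq hH y (((hj'.of_dvd (H.p_dvd_p hN)).add_right i).trans
    (modEq_firstFree_step hH (j + i)))]
  rfl

end Scale

namespace Scale

variable {H : Scale}

/-! ### The symbol function on the adding machine -/

lemma coord_eq_natCast_of_le (g : H.addingMachine) {j k n : ℕ} (hjk : j ≤ k)
    (h : g.1 k = n) : g.1 j = n := by
  induction k, hjk using Nat.le_induction with
  | base => exact h
  | succ k _ ih =>
    refine ih ?_
    have := g.2 k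
    rw [h, map_natCast] at this
    exact this.symm

lemma exists_natCast_eq_coord (g : H.addingMachine) (k : ℕ) :
    ∃ n : ℕ, ∀ j ≤ k, g.1 j = n :=
  ⟨(g.1 k).val, fun _ hj => coord_eq_natCast_of_le g hj (ZMod.natCast_zmod_val _).symm⟩

lemma coord_eq_of_le {g g' : H.addingMachine} {j k : ℕ} (hjk : j ≤ k) (h : g.1 k = g'.1 k) :
    g.1 j = g'.1 j := by
  obtain ⟨n, hn⟩ := exists_natCast_eq_coord g' k
  rw [hn j hjk, coord_eq_natCast_of_le g hjk (h.trans (hn k le_rfl))]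

lemma coord_nsmul_generator (n k : ℕ) : (n • H.generator).1 k = n := by
  simp [generator]

lemma coord_add (g g' : H.addingMachine) (k : ℕ) : (g + g').1 k = g.1 k + g'.1 k := rfl

lemma coord_neg_generator (k : ℕ) : (-H.generator).1 k = -1 := rfl

lemma natCast_eq_neg_one_iff {k n : ℕ} : (n : ZMod (H.p k)) = -1 ↔ H.p k ∣ n + 1 := by
  rw [eq_neg_iff_add_eq_zero, ← ZMod.natCast_eq_zero_iff]
  push_cast
  rfl

lemma firstFree_ne_neg_one (hH : 3 ≤ H.p 0) (k : ℕ) : (H.firstFree k : ZMod (H.p k)) ≠ -1 :=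
  fun h => not_modEq_firstFree hH one_pos one_le_two (natCast_eq_neg_one_iff.1 h) rfl

/-- The function on the adding machine whose values along the orbit of `0` form the Toeplitz
sequence. It is continuous except at the point `-(1, 1, …)`, which belongs to the closure, but not
to any, of the classes filled with `true`; there, the value `true` is chosen. -/
noncomputable def symbol (H : Scale) (y : ℕ → Bool) (g : H.addingMachine) : Bool :=
  open Classical in
  decide (g = -H.generator ∨ ∃ k, y k = true ∧ g.1 k = H.firstFree k)

variable {y : ℕ → Bool}

lemma symbol_eq_true_iff {g : H.addingMachine} :
    H.symbol y g = true ↔ g = -H.generator ∨ ∃ k, y k = true ∧ g.1 k = H.firstFree k := by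
  simp [symbol]

lemma symbol_neg_generator : H.symbol y (-H.generator) = true := symbol_eq_true_iff.2 (.inl rfl)

lemma symbol_eq (hH : 3 ≤ H.p 0) {g : H.addingMachine} {k : ℕ} (hg : g.1 k = H.firstFree k) :
    H.symbol y g = y k := by
  rw [Bool.eq_iff_iff, symbol_eq_true_iff]
  constructor
  · rintro (rfl | ⟨j, hj, hgj⟩)
    · exact (firstFree_ne_neg_one hH k hg.symm).elim
    · obtain ⟨n, hn⟩ := exists_natCast_eq_coord g (max j k)
      rw [hn j (le_max_left _ _), ZMod.natCast_eq_natCast_iff] at hgj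
      rw [hn k (le_max_right _ _), ZMod.natCast_eq_natCast_iff] at hg
      rwa [← eq_of_modEq_firstFree hH hgj hg]
  · exact fun h => .inr ⟨k, h, hg⟩

lemma symbol_nsmul_generator (hH : 3 ≤ H.p 0) (n : ℕ) :
    H.symbol y (n • H.generator) = H.toeplitz y n := by
  refine symbol_eq hH (k := H.step n) ?_
  rw [coord_nsmul_generator, ZMod.natCast_eq_natCast_iff]
  exact modEq_firstFree_step hH n

namespace Admissible

/-- Off the class of `-1` modulo `H.p J`, the symbol function depends on one coordinate only. -/
lemma exists_symbol_eq (hy : H.Admissible y) (J : ℕ) :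
    ∃ N, J ≤ N ∧ ∀ g g' : H.addingMachine, g.1 N = g'.1 N → g.1 J ≠ -1 →
      H.symbol y g = H.symbol y g' := by
  obtain ⟨N, hN⟩ := hy.dvd_of_true J
  refine ⟨max J N, le_max_left _ _, ?_⟩
  have key (g g' : H.addingMachine) (h : g.1 (max J N) = g'.1 (max J N)) (hg : g.1 J ≠ -1)
      (hs : H.symbol y g = true) : H.symbol y g' = true := by
    rcases symbol_eq_true_iff.1 hs with rfl | ⟨k, hk, hgk⟩
    · exact (hg rfl).elim
    refine symbol_eq_true_iff.2 (.inr ⟨k, hk, ?_⟩)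
    have hlt : k < max J N := by
      by_contra! hle
      refine hg ((coord_eq_natCast_of_le g ((le_max_left J N).trans hle) hgk).trans ?_)
      exact natCast_eq_neg_one_iff.2 (hN k ((le_max_right J N).trans hle) hk)
    rw [← coord_eq_of_le hlt.le h, hgk]
  intro g g' h hg
  rw [Bool.eq_iff_iff]
  refine ⟨key g g' h hg, key g' g h.symm ?_⟩
  rwa [← coord_eq_of_le (le_max_left J N) h]

/-- The associated sequence is a regular Toeplitz sequence: off the class of `-1` modulo `H.p J`
it is periodic. -/
lemma exists_toeplitz_eq (hH : 3 ≤ H.p 0) (hy : H.Admissible y) (J : ℕ) :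
    ∃ N, J ≤ N ∧ ∀ j j', j ≡ j' [MOD H.p N] → ¬ H.p J ∣ j + 1 →
      H.toeplitz y j = H.toeplitz y j' := by
  obtain ⟨N, hJN, hN⟩ := hy.exists_symbol_eq J
  refine ⟨N, hJN, fun j j' h hj => ?_⟩
  rw [← symbol_nsmul_generator hH, ← symbol_nsmul_generator hH]
  refine hN _ _ ?_ ?_
  · rwa [coord_nsmul_generator, coord_nsmul_generator, ZMod.natCast_eq_natCast_iff]
  · rwa [coord_nsmul_generator, Ne, natCast_eq_neg_one_iff]

/-- A class modulo `H.p k` which has not been filled with `true` by step `k + 1` contains positions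
carrying the symbol `false`. -/
lemma exists_modEq_eq_false (hH : 3 ≤ H.p 0) (hy : H.Admissible y) {a k : ℕ}
    (ha : ∀ j ≤ k, y j = true → ¬ a ≡ H.firstFree j [MOD H.p j]) :
    ∃ j t, y j = false ∧ t ≡ H.firstFree j [MOD H.p j] ∧ t ≡ a [MOD H.p k] := by
  by_cases hocc : a ∈ H.occupied (k + 1)
  · obtain ⟨j, hj, haj⟩ := H.mem_occupied.1 hocc
    exact ⟨j, a, by simpa using fun h => ha j (by omega) h haj, haj, rfl⟩
  by_cases hdvd : H.p k ∣ a + 1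
  · obtain ⟨j, -, hj, hjk⟩ := hy.exists_false k
    refine ⟨j, H.firstFree j, hj, rfl, Nat.ModEq.add_right_cancel' 1 ?_⟩
    exact ((Nat.modEq_zero_iff_dvd).2 hjk).trans ((Nat.modEq_zero_iff_dvd).2 hdvd).symm
  · obtain ⟨N, hN⟩ := hy.dvd_of_true k
    obtain ⟨t, hta, ht⟩ := exists_modEq_not_mem_occupied hocc (le_max_left k N)
    have hts := modEq_firstFree_step hH t
    have hstep : max k N < H.step t := by
      by_contra! hle
      exact ht (H.mem_occupied.2 ⟨_, by omega, hts⟩)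
    refine ⟨H.step t, t, ?_, hts, hta⟩
    rw [← Bool.not_eq_true]
    intro h
    refine hdvd ((hta.add_right 1).dvd_iff dvd_rfl |>.1 ?_)
    exact ((hts.of_dvd (H.p_dvd_p (by omega))).add_right 1).dvd_iff dvd_rfl |>.2
      (hN _ (by omega) h)

/-- The symbols along the forward orbit of a point of the adding machine determine the point. -/
lemma eq_of_symbol_eq (hH : 3 ≤ H.p 0) (hy : H.Admissible y) {g g' : H.addingMachine}
    (h : ∀ n : ℕ, H.symbol y (g + n • H.generator) = H.symbol y (g' + n • H.generator)) :
    g = g' := by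
  classical
  by_contra hne
  have hex : ∃ k, g.1 k ≠ g'.1 k := by
    by_contra! hall
    exact hne (Subtype.ext (funext hall))
  let k := Nat.find hex
  have hk : g.1 k ≠ g'.1 k := Nat.find_spec hex
  have hlt (j : ℕ) (hj : j < k) : g.1 j = g'.1 j := by simpa using Nat.find_min hex hj
  have hex' := hy.exists_true k
  let s := Nat.find hex'
  obtain ⟨hks, hs⟩ : k ≤ s ∧ y s = true := Nat.find_spec hex'
  have hmin (j : ℕ) (hj : j < s) (hyj : y j = true) : j < k := by
    by_contra! hkj
    exact Nat.find_min hex' hj ⟨hkj, hyj⟩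
  have hgs : g.1 s ≠ g'.1 s := fun h => hk (coord_eq_of_le hks h)
  -- The class `a` is to the class filled in step `s` as `g'` is to `g`.
  let δ : H.addingMachine := H.firstFree s • H.generator + (g' - g)
  obtain ⟨a, ha⟩ := exists_natCast_eq_coord δ s
  have hδ (j : ℕ) : δ.1 j = H.firstFree s + (g'.1 j - g.1 j) := by
    rw [coord_add, coord_nsmul_generator]
    rfl
  obtain ⟨j, t, hj, htj, hta⟩ := hy.exists_modEq_eq_false hH (a := a) (k := s) (by
    intro j hj hyj haj
    have haj' := (ha j hj).trans ((ZMod.natCast_eq_natCast_iff _ _ _).2 haj)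
    rw [hδ] at haj'
    rcases hj.lt_or_eq with hj | rfl
    · rw [hlt j (hmin j hj hyj), sub_self, add_zero, ZMod.natCast_eq_natCast_iff] at haj'
      exact hj.ne (eq_of_modEq_firstFree hH haj' rfl)
    · exact hgs (by linear_combination -haj'))
  -- Move `g'` into the class of `t`, which carries `false`; then `g` moves into the class filled
  -- in step `s`, which carries `true`.
  obtain ⟨n, hn⟩ := exists_natCast_eq_coord (t • H.generator - g') (max j s)
  have hn' (i : ℕ) (hi : i ≤ max j s) : g'.1 i + n = t := by
    rw [← hn i hi]
    change g'.1 i + ((t • H.generator).1 i - g'.1 i) = t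
    rw [coord_nsmul_generator]
    ring
  have h1 : H.symbol y (g' + n • H.generator) = false := by
    rw [← hj]
    refine symbol_eq hH ?_
    rw [coord_add, coord_nsmul_generator, hn' j (le_max_left _ _)]
    exact (ZMod.natCast_eq_natCast_iff _ _ _).2 htj
  have h2 : H.symbol y (g + n • H.generator) = true := by
    rw [← hs]
    refine symbol_eq hH ?_
    have e1 := hn' s (le_max_right _ _)
    have e2 := (ZMod.natCast_eq_natCast_iff _ _ _).2 hta
    have e3 := ha s le_rfl
    rw [hδ] at e3
    rw [coord_add, coord_nsmul_generator]
    linear_combination e1 + e2 - e3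
  rw [h n, h1] at h2
  exact Bool.false_ne_true h2

end Admissible

/-! ### Haar measure -/

instance : StandardBorelSpace H.addingMachine :=
  MeasurableSet.standardBorel H.isClosed_addingMachine.measurableSet

instance : IsProbabilityMeasure H.haar := ⟨Measure.addHaarMeasure_self⟩

lemma measurePreserving_tau : MeasurePreserving H.tau H.haar H.haar := by
  have : H.haar.IsAddLeftInvariant := inferInstanceAs (Measure.addHaarMeasure ⊤).IsAddLeftInvariant
  exact measurePreserving_add_right H.haar H.generator

lemma measurable_symbol : Measurable (H.symbol y) := by
  refine measurable_to_bool ?_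
  have : H.symbol y ⁻¹' {true} = {-H.generator} ∪
      ⋃ k, ⋃ (_ : y k = true), {g : H.addingMachine | g.1 k = H.firstFree k} := by
    ext g
    simp [symbol_eq_true_iff]
  rw [this]
  refine (measurableSet_singleton _).union
    (.iUnion fun k => .iUnion fun _ => ?_)
  exact ((measurable_pi_apply k).comp measurable_subtype_coe) (measurableSet_singleton _)

end Scale

/-! ### Subshifts over `ℕ` and `ℤ` -/

/-- The index sets `ℕ` and `ℤ`: each finite subset is contained in a window
`{a, a + 1, …, a + n - 1}`. -/
class HasWindows (Γ : Type*) [AddCommMonoidWithOne Γ] : Prop where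
  exists_window (s : Finset Γ) : ∃ (a : Γ) (n : ℕ), ∀ t ∈ s, ∃ i < n, t = a + (i : ℕ)

instance : HasWindows ℕ where
  exists_window s := ⟨0, s.sup id + 1, fun t ht =>
    ⟨t, Nat.lt_succ_of_le (Finset.le_sup (f := id) ht), by simp⟩⟩

instance : HasWindows ℤ where
  exists_window s := by
    obtain ⟨b, hb⟩ := s.bddBelow
    obtain ⟨c, hc⟩ := s.bddAbove
    refine ⟨b, (c - b).toNat + 1, fun t ht => ⟨(t - b).toNat, ?_, ?_⟩⟩
    · have := hb ht
      have := hc ht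
      omega
    · have := hb ht
      omega

/-- The subshift generated by a one-sided sequence `x`: all configurations each of whose finite
blocks occurs in `x`. -/
def wordSubshift (Γ : Type*) [AddCommMonoidWithOne Γ] {Λ : Type*} (x : ℕ → Λ) : Set (Γ → Λ) :=
  {z | ∀ (a : Γ) (n : ℕ), ∃ j : ℕ, ∀ i < n, z (a + (i : ℕ)) = x (j + i)}

section Windows

variable {Γ : Type*} [AddCommMonoidWithOne Γ]

lemma iterate_shift_apply {Λ : Type*} (n : ℕ) (z : Γ → Λ) (t : Γ) :
    ((shift (1 : Γ))^[n] z) t = z (n + t) := by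
  induction n generalizing t with
  | zero => simp
  | succ n ih =>
    rw [Function.iterate_succ_apply', shift_apply, ih, Nat.cast_succ, add_assoc]

variable [HasWindows Γ]

lemma exists_window_of_mem_uniformity {U : Set ((Γ → Bool) × (Γ → Bool))}
    (hU : U ∈ 𝓤 (Γ → Bool)) :
    ∃ (a : Γ) (n : ℕ), ∀ z z' : Γ → Bool, (∀ i < n, z (a + (i : ℕ)) = z' (a + (i : ℕ))) →
      (z, z') ∈ U := by
  rw [Pi.uniformity, Filter.mem_iInf] at hU
  obtain ⟨I, hI, V, hV, rfl⟩ := hU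
  obtain ⟨a, n, h⟩ := HasWindows.exists_window hI.toFinset
  refine ⟨a, n, fun z z' hz => Set.mem_iInter.2 fun t => ?_⟩
  obtain ⟨W, hW, hWV⟩ := hV t
  obtain ⟨i, hi, hti⟩ := h t (by simp)
  refine hWV (?_ : (z t, z' t) ∈ W)
  rw [hti, hz i hi]
  exact refl_mem_uniformity hW

lemma mem_closure_of_forall_window {S : Set (Γ → Bool)} {z : Γ → Bool}
    (h : ∀ (a : Γ) (n : ℕ), ∃ z' ∈ S, ∀ i < n, z (a + (i : ℕ)) = z' (a + (i : ℕ))) :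
    z ∈ closure S := by
  rw [UniformSpace.mem_closure_iff_ball]
  intro V hV
  obtain ⟨a, n, hw⟩ := exists_window_of_mem_uniformity hV
  obtain ⟨z', hz', h⟩ := h a n
  exact ⟨z', hw z z' h, hz'⟩

omit [HasWindows Γ] in
lemma isClosed_wordSubshift (x : ℕ → Bool) : IsClosed (wordSubshift Γ x) := by
  have : wordSubshift Γ x = ⋂ (a : Γ) (n : ℕ),
      (fun (z : Γ → Bool) (i : Fin n) => z (a + (i : ℕ))) ⁻¹'
        {w | ∃ j : ℕ, ∀ i : Fin n, w i = x (j + i)} := by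
    ext z
    simp [wordSubshift, Fin.forall_iff]
  rw [this]
  refine isClosed_iInter fun a => isClosed_iInter fun n => IsClosed.preimage ?_ (isClosed_discrete _)
  exact continuous_pi fun i => continuous_apply _

omit [HasWindows Γ] in
lemma mapsTo_shift_wordSubshift {Λ : Type*} (x : ℕ → Λ) :
    Set.MapsTo (shift (1 : Γ)) (wordSubshift Γ x) (wordSubshift Γ x) := fun z hz a n => by
  obtain ⟨j, hj⟩ := hz (1 + a) n
  exact ⟨j, fun i hi => by rw [← hj i hi, shift_apply, add_assoc]⟩

end Windows

lemma bilateralSubshift_eq {Λ : Type*} (x : ℕ → Λ) : bilateralSubshift x = wordSubshift ℤ x := rfl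

lemma orbitClosure_eq (x : ℕ → Bool) : orbitClosure x = wordSubshift ℕ x := by
  refine Set.Subset.antisymm (closure_minimal ?_ (isClosed_wordSubshift x)) fun z hz => ?_
  · rintro _ ⟨k, rfl⟩ a n
    exact ⟨k + a, fun i _ => congrArg x (add_assoc k a i).symm⟩
  · refine mem_closure_of_forall_window fun a n => ?_
    obtain ⟨j, hj⟩ := hz 0 (a + n)
    refine ⟨shift j x, ⟨j, rfl⟩, fun i hi => ?_⟩
    simpa using hj (a + i) (by omega)

namespace Scale

variable {H : Scale} {y : ℕ → Bool} {Γ : Type*} [AddCommMonoidWithOne Γ]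

/-! ### Minimality -/

/-- Every word of the Toeplitz sequence occurs in every point of the subshift. -/
lemma exists_iterate_shift_eq (hH : 3 ≤ H.p 0) {Λ : Type*} (y : ℕ → Λ) {z : Γ → Λ}
    (hz : z ∈ wordSubshift Γ (H.toeplitz y)) (a : Γ) (j n : ℕ) :
    ∃ s : ℕ, ∀ i < n, ((shift (1 : Γ))^[s] z) (a + (i : ℕ)) = H.toeplitz y (j + i) := by
  obtain ⟨P, hP, hrec⟩ := exists_recurrence hH y j n
  obtain ⟨b, hb⟩ := hz a (P + n)
  obtain ⟨s, hs, hmod⟩ : ∃ s < P, b + s ≡ j [MOD P] := by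
    refine ⟨(j + (P - b % P)) % P, Nat.mod_lt _ hP, ?_⟩
    have h1 : b % P < P := Nat.mod_lt _ hP
    calc b + (j + (P - b % P)) % P ≡ b % P + (j + (P - b % P)) [MOD P] :=
          (Nat.mod_modEq b P).symm.add (Nat.mod_modEq _ P)
      _ = j + P := by omega
      _ ≡ j [MOD P] := by simp [Nat.ModEq]
  refine ⟨s, fun i hi => ?_⟩
  rw [iterate_shift_apply, ← hrec _ hmod i hi, add_assoc b, ← hb (s + i) (by omega)]
  congr 1
  push_cast
  rw [add_left_comm]

lemma isMinimalSystem_wordSubshift [HasWindows Γ] (hH : 3 ≤ H.p 0) (y : ℕ → Bool)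
    (hne : (wordSubshift Γ (H.toeplitz y)).Nonempty) :
    IsMinimalSystem (shift (1 : Γ)) (wordSubshift Γ (H.toeplitz y)) := by
  refine ⟨hne, isClosed_wordSubshift _, mapsTo_shift_wordSubshift _, fun z hz z' hz' => ?_⟩
  refine mem_closure_of_forall_window fun a n => ?_
  obtain ⟨j, hj⟩ := hz' a n
  obtain ⟨s, hs⟩ := exists_iterate_shift_eq hH y hz a j n
  exact ⟨_, ⟨s, rfl⟩, fun i hi => (hj i hi).trans (hs i hi).symm⟩

/-! ### Entropy zero -/

/-- For a suitable `N`, a word in the subshift is determined by a position, modulo `H.p N`, at which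
it occurs in the Toeplitz sequence, and by its symbols at the places which are `-1` modulo `H.p J`. -/
lemma Admissible.coverMincard_le [HasWindows Γ] (hH : 3 ≤ H.p 0) (hy : H.Admissible y) (J : ℕ) :
    ∃ q : ℕ, ∀ (U : Set ((Γ → Bool) × (Γ → Bool))) (a : Γ) (w : ℕ),
      (∀ z z' : Γ → Bool, (∀ i < w, z (a + (i : ℕ)) = z' (a + (i : ℕ))) → (z, z') ∈ U) → ∀ n,
      Dynamics.coverMincard (shift (1 : Γ)) (wordSubshift Γ (H.toeplitz y)) U n ≤
        (q * 2 ^ ((n + w) / H.p J + 1) : ℕ) := by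
  classical
  obtain ⟨N, hJN, hN⟩ := hy.exists_toeplitz_eq hH J
  refine ⟨H.p N, fun U a w hU n => ?_⟩
  set X := wordSubshift Γ (H.toeplitz y)
  have hX (z : X) := z.2 a (n + w)
  choose b hb using hX
  let M := (n + w) / H.p J + 1
  -- the least `i` with `H.p J ∣ r + i + 1`
  let first : ℕ → ℕ := fun r => H.p J - 1 - r % H.p J
  let code : X → Fin (H.p N) × (Fin M → Bool) := fun z =>
    (⟨b z % H.p N, Nat.mod_lt _ (H.pos N)⟩,
      fun e => z.1 (a + ((first (b z % H.p N) + e * H.p J : ℕ) : Γ)))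
  have hcode (z z' : X) (h : code z = code z') (i : ℕ) (hi : i < n + w) :
      z.1 (a + (i : ℕ)) = z'.1 (a + (i : ℕ)) := by
    have hmod : b z % H.p N = b z' % H.p N := congrArg (fun c => (c.1 : ℕ)) h
    by_cases hdvd : H.p J ∣ b z + i + 1
    · have hJ := H.pos J
      have hr : b z % H.p N % H.p J = b z % H.p J := Nat.mod_mod_of_dvd _ (H.p_dvd_p hJN)
      have hlt := Nat.mod_lt (b z) hJ
      obtain ⟨c, hc⟩ : H.p J ∣ b z % H.p J + (i + 1) := by
        rw [← Nat.modEq_zero_iff_dvd] at hdvd ⊢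
        exact ((Nat.mod_modEq _ _).add_right _).trans hdvd
      obtain ⟨e, rfl⟩ : ∃ e, c = e + 1 := Nat.exists_eq_succ_of_ne_zero (by
        rintro rfl
        omega)
      rw [mul_add, mul_one, mul_comm] at hc
      have hi' : i = first (b z % H.p N) + e * H.p J := by
        simp only [first, hr]
        omega
      have he : e < M := Nat.lt_succ_of_le ((Nat.le_div_iff_mul_le hJ).2 (by omega))
      have := congrFun (congrArg Prod.snd h) ⟨e, he⟩
      simp only [code, ← hmod, ← hi'] at this
      exact this
    · rw [hb z i hi, hb z' i hi]
      exact hN _ _ (Nat.ModEq.add_right i hmod) hdvd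
  obtain ⟨s, hs⟩ : ∃ s : Finset X, s.card ≤ H.p N * 2 ^ M ∧ ∀ z, ∃ z' ∈ s, code z = code z' := by
    refine ⟨Finset.univ.image (Set.rangeSplitting code), ?_, fun z =>
      ⟨_, Finset.mem_image_of_mem _ (Finset.mem_univ ⟨code z, Set.mem_range_self z⟩),
        (Set.apply_rangeSplitting code ⟨code z, Set.mem_range_self z⟩).symm⟩⟩
    refine Finset.card_image_le.trans ((Fintype.card_subtype_le _).trans_eq ?_)
    simp
  have hcov : Dynamics.IsDynCoverOf (shift (1 : Γ)) X U n
      ((s.map (Function.Embedding.subtype _) : Finset (Γ → Bool)) : Set (Γ → Bool)) := by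
    intro z hz
    obtain ⟨z', hz's, hzz'⟩ := hs.2 ⟨z, hz⟩
    refine ⟨z', by simpa using hz's, Dynamics.mem_dynEntourage.2 fun k hk => hU _ _ fun i hi => ?_⟩
    rw [iterate_shift_apply, iterate_shift_apply, add_left_comm, ← Nat.cast_add]
    exact hcode ⟨z, hz⟩ z' hzz' (k + i) (by omega)
  refine hcov.coverMincard_le_card.trans ?_
  rw [Finset.card_map]
  exact_mod_cast hs.1

lemma Admissible.coverEntropy_eq_zero [HasWindows Γ] (hH : 3 ≤ H.p 0) (hy : H.Admissible y)
    (hne : (wordSubshift Γ (H.toeplitz y)).Nonempty) :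
    Dynamics.coverEntropy (shift (1 : Γ)) (wordSubshift Γ (H.toeplitz y)) = 0 := by
  refine le_antisymm (iSup₂_le fun U hU => ?_) (Dynamics.coverEntropy_nonneg _ hne)
  obtain ⟨a, w, hw⟩ := exists_window_of_mem_uniformity hU
  -- The relation `W` is an equivalence relation, whence `W ○ W ⊆ W`.
  let W : SetRel (Γ → Bool) (Γ → Bool) :=
    {z | ∀ i < w, z.1 (a + (i : ℕ)) = z.2 (a + (i : ℕ))}
  have hWsymm : W.IsSymm := ⟨fun z z' h i hi => (h i hi).symm⟩
  have hWU : SetRel.comp W W ⊆ U := by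
    rintro ⟨z, z'⟩ ⟨z'', h, h'⟩
    exact hw _ _ fun i hi => (h i hi).trans (h' i hi)
  have key (J : ℕ) : Dynamics.coverEntropyEntourage (shift (1 : Γ))
      (wordSubshift Γ (H.toeplitz y)) U ≤ ((2 * Real.log 2 * ((H.p J : ℝ))⁻¹ : ℝ) : EReal) := by
    obtain ⟨q, hcov⟩ := hy.coverMincard_le (Γ := Γ) hH J
    have hJ := H.pos J
    have hn : H.p J * (q + w + 1) ≠ 0 := by positivity
    refine (Dynamics.coverEntropyEntourage_antitone _ _ hWU).trans
      ((Dynamics.coverEntropyEntourage_le_log_coverMincard_div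
        (mapsTo_shift_wordSubshift _) hn).trans ?_)
    have hcard : Dynamics.coverMincard (shift (1 : Γ)) (wordSubshift Γ (H.toeplitz y)) W
        (H.p J * (q + w + 1)) ≤ (2 ^ (2 * (q + w + 1)) : ℕ) := by
      refine (hcov W a w (fun _ _ h => h) _).trans ?_
      norm_cast
      calc q * 2 ^ ((H.p J * (q + w + 1) + w) / H.p J + 1)
          ≤ 2 ^ q * 2 ^ (q + w + 1 + w + 1) := by
            gcongr
            · exact q.lt_two_pow_self.le
            · exact one_le_two
            · rw [Nat.mul_add_div hJ]
              gcongr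
              exact Nat.div_le_self _ _
        _ = 2 ^ (2 * (q + w + 1)) := by ring
    have hlog : ENNReal.log (Dynamics.coverMincard (shift (1 : Γ))
        (wordSubshift Γ (H.toeplitz y)) W (H.p J * (q + w + 1))) ≤
        ((2 * (q + w + 1 : ℕ) * Real.log 2 : ℝ) : EReal) := by
      refine (ENNReal.log_monotone (ENat.toENNReal_mono hcard)).trans_eq ?_
      rw [ENat.toENNReal_coe, Nat.cast_pow, ENNReal.log_pow, ENNReal.log_pos_real (by simp) (by simp)]
      push_cast
      rw [ENNReal.toReal_ofNat]
      norm_cast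
    refine (EReal.monotone_div_right_of_nonneg (Nat.cast_nonneg' _) hlog).trans_eq ?_
    beta_reduce
    rw [← EReal.coe_natCast, ← EReal.coe_div]
    congr 1
    push_cast
    field_simp
  refine ge_of_tendsto' (x := Filter.atTop) (f := fun J : ℕ =>
    ((2 * Real.log 2 * ((H.p J : ℝ))⁻¹ : ℝ) : EReal)) ?_ key
  rw [← EReal.coe_zero, EReal.tendsto_coe, ← mul_zero (2 * Real.log 2)]
  exact ((tendsto_natCast_atTop_atTop.comp H.strictMono.tendsto_atTop).inv_tendsto_atTop).const_mul _

end Scale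

/-! ### Unique ergodicity -/

/-- Among `q` consecutive numbers exactly `q / d` are multiples of a divisor `d` of `q`. -/
lemma Nat.card_filter_dvd_Ico {d q : ℕ} (h : d ∣ q) (m : ℕ) :
    ((Finset.Ico m (m + q)).filter (d ∣ ·)).card = q / d := by
  have hp : Function.Periodic (d ∣ ·) q := fun t => propext (Nat.dvd_add_left h)
  rw [Nat.filter_Ico_card_eq_of_periodic m q _ hp, ← Nat.filter_Ico_card_eq_of_periodic 1 q _ hp,
    ← Nat.Ioc_filter_dvd_card_eq_div]
  congr 2
  ext t
  simp only [Finset.mem_Ico, Finset.mem_Ioc]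
  omega

namespace Scale

variable {H : Scale} {y : ℕ → Bool} {Γ : Type*} [AddCommMonoidWithOne Γ]

/-- The number of visits to a cylinder set during one period `q = H.p N` is nearly independent
of the starting point in the subshift: visits whose window avoids the class of `-1` modulo `H.p J`
only depend on the position modulo `q`, and few windows meet that class. -/
lemma Admissible.exists_visits_bounds (hH : 3 ≤ H.p 0) (hy : H.Admissible y) (J n : ℕ)
    (S : Set (Fin n → Bool)) :
    ∃ q c : ℕ, 0 < q ∧ H.p J ∣ q ∧ ∀ (a : Γ), ∀ z ∈ wordSubshift Γ (H.toeplitz y),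
      (c : ENNReal) ≤ ∑ s ∈ Finset.range q,
        {z : Γ → Bool | (fun i : Fin n => z (a + (i : ℕ))) ∈ S}.indicator 1
          ((shift (1 : Γ))^[s] z) ∧
      ∑ s ∈ Finset.range q, {z : Γ → Bool | (fun i : Fin n => z (a + (i : ℕ))) ∈ S}.indicator 1
          ((shift (1 : Γ))^[s] z) ≤ ((c + n * (q / H.p J) : ℕ) : ENNReal) := by
  classical
  obtain ⟨N, hJN, hN⟩ := hy.exists_toeplitz_eq hH J
  set x := H.toeplitz y
  set q := H.p N
  have hq : H.p J ∣ q := H.p_dvd_p hJN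
  let D : ℕ → Prop := fun t => (fun i : Fin n => x (t + i)) ∈ S
  let good : ℕ → Prop := fun t => ∀ i < n, ¬ H.p J ∣ t + i + 1
  have hper : Function.Periodic (fun t => good t ∧ D t) q := by
    intro t
    have hgood : good (t + q) ↔ good t := by
      refine forall₂_congr fun i _ => not_congr ?_
      rw [show t + q + i + 1 = t + i + 1 + q by ring, Nat.dvd_add_left hq]
    have hD (h : good t) : D (t + q) ↔ D t := by
      refine iff_of_eq (congrArg (· ∈ S) (funext fun i => ?_))
      refine (hN (t + i) (t + q + i) ?_ (h i i.2)).symm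
      simp [Nat.ModEq, add_right_comm t q]
    exact propext ⟨fun h => ⟨hgood.1 h.1, (hD (hgood.1 h.1)).1 h.2⟩,
      fun h => ⟨hgood.2 h.1, (hD h.1).2 h.2⟩⟩
  refine ⟨q, Nat.count (fun t => good t ∧ D t) q, H.pos N, hq, fun a z hz => ?_⟩
  obtain ⟨j, hj⟩ := hz a (q + n)
  have hsum : ∑ s ∈ Finset.range q,
      {z : Γ → Bool | (fun i : Fin n => z (a + (i : ℕ))) ∈ S}.indicator (1 : (Γ → Bool) → ENNReal)
        ((shift (1 : Γ))^[s] z) = (((Finset.Ico j (j + q)).filter D).card : ENNReal) := by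
    rw [← Finset.sum_boole, Finset.sum_Ico_eq_sum_range, Nat.add_sub_cancel_left]
    refine Finset.sum_congr rfl fun s hs => ?_
    rw [Set.indicator_apply]
    refine if_congr ?_ rfl rfl
    refine iff_of_eq (congrArg (· ∈ S) (funext fun i => ?_))
    rw [iterate_shift_apply, add_left_comm, ← Nat.cast_add, hj _ (by
      have := Finset.mem_range.1 hs
      omega), add_assoc]
  rw [hsum, ← Nat.filter_Ico_card_eq_of_periodic j q _ hper]
  refine ⟨Nat.cast_le.2 (Finset.card_le_card fun t ht => ?_), ?_⟩
  · simp only [Finset.mem_filter] at ht ⊢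
    exact ⟨ht.1, ht.2.2⟩
  norm_cast
  have hbad : ((Finset.Ico j (j + q)).filter fun t => ¬ good t).card ≤ n * (q / H.p J) := by
    calc _ ≤ ((Finset.range n).biUnion fun i =>
          (Finset.Ico j (j + q)).filter fun t => H.p J ∣ t + i + 1).card := by
          refine Finset.card_le_card fun t ht => ?_
          simp only [Finset.mem_filter, good, not_forall, not_not] at ht
          obtain ⟨ht, i, hi, hdvd⟩ := ht
          simp only [Finset.mem_biUnion, Finset.mem_range, Finset.mem_filter]
          exact ⟨i, hi, ht, hdvd⟩
      _ ≤ ∑ i ∈ Finset.range n, q / H.p J := by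
          refine Finset.card_biUnion_le.trans (Finset.sum_le_sum fun i _ => ?_)
          rw [← Nat.card_filter_dvd_Ico hq (j + (i + 1))]
          refine Finset.card_le_card_of_injOn (· + (i + 1)) (fun t ht => ?_)
            (add_left_injective _).injOn
          simp only [Finset.coe_filter, Set.mem_ofPred_eq, Finset.mem_Ico] at ht ⊢
          exact ⟨by omega, ht.2⟩
      _ = n * (q / H.p J) := by simp
  refine le_trans ?_ (Nat.add_le_add_left hbad _)
  refine le_trans (Finset.card_le_card fun t ht => ?_) (Finset.card_union_le _ _)
  simp only [Finset.mem_union, Finset.mem_filter] at ht ⊢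
  tauto

/-- Integrating the number of visits during one period shows that two invariant measures differ by
at most `n / H.p J` on a cylinder set with window length `n`, for every `J`. -/
lemma Admissible.measure_window_le [Countable Γ] (hH : 3 ≤ H.p 0) (hy : H.Admissible y)
    {μ ν : Measure (Γ → Bool)}
    (hμ : IsInvariantProb (shift (1 : Γ)) (wordSubshift Γ (H.toeplitz y)) μ)
    (hν : IsInvariantProb (shift (1 : Γ)) (wordSubshift Γ (H.toeplitz y)) ν)
    (a : Γ) (n : ℕ) (S : Set (Fin n → Bool)) :
    μ {z | (fun i : Fin n => z (a + (i : ℕ))) ∈ S} ≤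
      ν {z | (fun i : Fin n => z (a + (i : ℕ))) ∈ S} := by
  set B : Set (Γ → Bool) := {z | (fun i : Fin n => z (a + (i : ℕ))) ∈ S}
  have hB : MeasurableSet B :=
    (measurable_pi_lambda _ fun i : Fin n => measurable_pi_apply (a + ((i : ℕ) : Γ)))
      (MeasurableSet.of_discrete (s := S))
  have hint {μ : Measure (Γ → Bool)} (hμ : MeasurePreserving (shift (1 : Γ)) μ μ) (q : ℕ) :
      ∫⁻ z, ∑ s ∈ Finset.range q, B.indicator 1 ((shift (1 : Γ))^[s] z) ∂μ = q * μ B := by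
    rw [lintegral_finsetSum (f := fun s z => B.indicator 1 ((shift (1 : Γ))^[s] z)) _ fun s _ =>
      (measurable_one.indicator hB).comp (hμ.iterate s).measurable]
    rw [Finset.sum_congr rfl fun s _ => (hμ.iterate s).lintegral_comp (measurable_one.indicator hB)]
    simp [lintegral_indicator_one hB]
  have := hμ.1
  have := hν.1
  have key (J : ℕ) : μ B ≤ ν B + n * (H.p J : ENNReal)⁻¹ := by
    obtain ⟨q, c, hq, hJq, h⟩ := hy.exists_visits_bounds (Γ := Γ) hH J n S
    have h1 : q * μ B ≤ (c + n * (q / H.p J) : ℕ) := by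
      rw [← hint hμ.2.1]
      refine (lintegral_mono_ae (g := fun _ => ((c + n * (q / H.p J) : ℕ) : ENNReal)) ?_).trans_eq
        (by simp)
      filter_upwards [measure_eq_zero_iff_ae_notMem.1 hμ.2.2] with z hz
      exact (h a z (by simpa using hz)).2
    have h2 : (c : ENNReal) ≤ q * ν B := by
      rw [← hint hν.2.1]
      refine le_trans (by simp) (lintegral_mono_ae (f := fun _ => (c : ENNReal)) ?_)
      filter_upwards [measure_eq_zero_iff_ae_notMem.1 hν.2.2] with z hz
      exact (h a z (by simpa using hz)).1
    obtain ⟨e, rfl⟩ := hJq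
    have hJ : (H.p J : ENNReal) ≠ 0 := by exact_mod_cast (H.pos J).ne'
    rw [Nat.mul_div_cancel_left e (H.pos J)] at h1
    refine (ENNReal.mul_le_mul_iff_right (a := ((H.p J * e : ℕ) : ENNReal))
      (by exact_mod_cast hq.ne') (ENNReal.natCast_ne_top _)).1 (h1.trans ?_)
    rw [mul_add]
    push_cast at h2 ⊢
    refine add_le_add h2 (le_of_eq ?_)
    calc (n : ENNReal) * e = n * e * (H.p J * (H.p J : ENNReal)⁻¹) := by
          rw [ENNReal.mul_inv_cancel hJ (ENNReal.natCast_ne_top _), mul_one]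
      _ = H.p J * e * (n * (H.p J : ENNReal)⁻¹) := by ring
  refine ge_of_tendsto' (x := Filter.atTop)
    (f := fun J : ℕ => ν B + n * (H.p J : ENNReal)⁻¹) ?_ key
  have := ENNReal.Tendsto.const_mul (a := (n : ENNReal))
    (ENNReal.tendsto_inv_nat_nhds_zero.comp H.strictMono.tendsto_atTop)
    (.inr (ENNReal.natCast_ne_top n))
  simpa using this.const_add (ν B)

lemma Admissible.measure_eq [Countable Γ] [HasWindows Γ] (hH : 3 ≤ H.p 0) (hy : H.Admissible y)
    {μ ν : Measure (Γ → Bool)}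
    (hμ : IsInvariantProb (shift (1 : Γ)) (wordSubshift Γ (H.toeplitz y)) μ)
    (hν : IsInvariantProb (shift (1 : Γ)) (wordSubshift Γ (H.toeplitz y)) ν) : μ = ν := by
  have := hμ.1
  have := hν.1
  refine IsProjectiveLimit.unique (P := fun I => ν.map I.restrict) (fun I => ?_) fun I => rfl
  ext S hS
  rw [Measure.map_apply (Finset.measurable_restrict I) hS,
    Measure.map_apply (Finset.measurable_restrict I) hS]
  obtain ⟨a, n, h⟩ := HasWindows.exists_window I
  have : I.restrict ⁻¹' S = {z : Γ → Bool | (fun i : Fin n => z (a + (i : ℕ))) ∈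
      (fun z (i : Fin n) => z (a + (i : ℕ))) '' (I.restrict ⁻¹' S : Set (Γ → Bool))} := by
    refine Set.Subset.antisymm (fun z hz => ⟨z, hz, rfl⟩) ?_
    rintro z ⟨z', hz', hzz'⟩
    have : I.restrict z = I.restrict z' := funext fun t => by
      obtain ⟨i, hi, hti⟩ := h t t.2
      have := congrFun hzz' ⟨i, hi⟩
      simp only [Finset.restrict, hti]
      exact this.symm
    rwa [Set.mem_preimage, this]
  rw [this]
  exact le_antisymm (hy.measure_window_le hH hμ hν a n _) (hy.measure_window_le hH hν hμ a n _)

/-! ### Coding of the odometer -/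

/-- The itinerary of a point of the adding machine, read by the symbol function. The time `t`
acts by translation by `c t`. -/
noncomputable def coding (c : Γ →+ H.addingMachine) (y : ℕ → Bool) (g : H.addingMachine) :
    Γ → Bool :=
  fun t => H.symbol y (g + c t)

variable {c : Γ →+ H.addingMachine}

lemma map_natCast_of_map_one (hc : c 1 = H.generator) (n : ℕ) : c n = n • H.generator := by
  rw [← nsmul_one, map_nsmul, hc]

lemma shift_coding (hc : c 1 = H.generator) (g : H.addingMachine) :
    shift (1 : Γ) (coding c y g) = coding c y (H.tau g) := by
  ext t
  simp [coding, tau, hc, add_assoc]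

lemma measurable_coding (c : Γ →+ H.addingMachine) : Measurable (coding c y) :=
  measurable_pi_lambda _ fun t => measurable_symbol.comp (measurable_add_const (c t))

lemma coding_injective (hH : 3 ≤ H.p 0) (hy : H.Admissible y) (hc : c 1 = H.generator) :
    Function.Injective (coding c y) := fun g g' h => by
  refine hy.eq_of_symbol_eq hH fun n => ?_
  have := congrFun h (n : Γ)
  rwa [coding, coding, map_natCast_of_map_one hc] at this

/-- Itineraries lie in the subshift, also those passing through the point of discontinuity. -/
lemma coding_mem (hH : 3 ≤ H.p 0) (hy : H.Admissible y) (hc : c 1 = H.generator)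
    (g : H.addingMachine) : coding c y g ∈ wordSubshift Γ (H.toeplitz y) := by
  intro a n
  set h := g + c a with hh
  have hcod (i : ℕ) : coding c y g (a + i) = H.symbol y (h + i • H.generator) := by
    rw [coding, map_add, map_natCast_of_map_one hc, ← add_assoc]
  simp only [hcod, ← symbol_nsmul_generator hH]
  have hcoord (g : H.addingMachine) (i k : ℕ) : (g + i • H.generator).1 k = g.1 k + i := by
    rw [coord_add, coord_nsmul_generator]
  by_cases hhole : ∃ i₀ < n, h + i₀ • H.generator = -H.generator
  · -- The window contains the point of discontinuity; its value `true` is that of `x` at a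
    -- position which is close to `-1` and filled with `true`.
    obtain ⟨i₀, hi₀, h0⟩ := hhole
    obtain ⟨N, hnN, hN⟩ := hy.exists_symbol_eq n
    obtain ⟨k₀, hk₀⟩ := hy.dvd_of_true N
    obtain ⟨k, hk, hyk⟩ := hy.exists_true k₀
    have hdvd := hk₀ k hk hyk
    have hpn := H.lt_p n
    have hle : i₀ ≤ H.firstFree k := by
      have h1 := Nat.le_of_dvd (Nat.succ_pos _) hdvd
      have h2 := H.strictMono.monotone hnN
      omega
    have hcoord0 (l : ℕ) : h.1 l + i₀ = -1 := by
      rw [← hcoord, h0, coord_neg_generator]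
    refine ⟨H.firstFree k - i₀, fun i hi => ?_⟩
    by_cases hii : i = i₀
    · subst hii
      rw [h0, symbol_neg_generator, Nat.sub_add_cancel hle, symbol_nsmul_generator hH,
        toeplitz_firstFree hH, hyk]
    · refine hN _ _ ?_ fun hcon => hii ?_
      · rw [hcoord, coord_nsmul_generator]
        have h1 := natCast_eq_neg_one_iff.2 hdvd
        push_cast [hle]
        linear_combination hcoord0 N - h1
      · rw [hcoord, ← hcoord0 n, add_right_inj, ZMod.natCast_eq_natCast_iff] at hcon
        exact hcon.eq_of_lt_of_lt (by omega) (by omega)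
  · push Not at hhole
    have hex (i : ℕ) : ∃ J, i < n → (h + i • H.generator).1 J ≠ -1 := by
      by_contra! hcon
      exact hhole i (hcon 0).1 (Subtype.ext (funext fun J => (hcon J).2))
    choose J hJ using hex
    let M := (Finset.range n).sup J
    have hM (i : ℕ) (hi : i < n) : (h + i • H.generator).1 M ≠ -1 := fun hcon =>
      hJ i hi (coord_eq_of_le (g' := -H.generator) (Finset.le_sup (Finset.mem_range.2 hi)) hcon)
    obtain ⟨N, hMN, hN⟩ := hy.exists_symbol_eq M
    obtain ⟨j, hj⟩ := exists_natCast_eq_coord h N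
    refine ⟨j, fun i hi => hN _ _ ?_ (hM i hi)⟩
    rw [hcoord, hj N le_rfl, coord_nsmul_generator, Nat.cast_add]

lemma Admissible.strictlyErgodic_and_isomorphic [Countable Γ] [HasWindows Γ] (hH : 3 ≤ H.p 0)
    (hy : H.Admissible y) (hc : c 1 = H.generator) :
    IsStrictlyErgodic (shift (1 : Γ)) (wordSubshift Γ (H.toeplitz y)) ∧
      Dynamics.coverEntropy (shift (1 : Γ)) (wordSubshift Γ (H.toeplitz y)) = 0 ∧
      ∃ μ : Measure (Γ → Bool),
        IsInvariantProb (shift (1 : Γ)) (wordSubshift Γ (H.toeplitz y)) μ ∧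
        MeasureIsomorphic (shift (1 : Γ)) μ H.tau H.haar := by
  have hne : (wordSubshift Γ (H.toeplitz y)).Nonempty := ⟨_, coding_mem hH hy hc 0⟩
  have hmeas := measurable_coding (y := y) c
  have hemb := hmeas.measurableEmbedding (coding_injective hH hy hc)
  have hshift : Measurable (shift (1 : Γ) : (Γ → Bool) → Γ → Bool) :=
    measurable_pi_lambda _ fun t => measurable_pi_apply _
  have hpres : MeasurePreserving (coding c y) H.haar (H.haar.map (coding c y)) :=
    ⟨hmeas, rfl⟩
  have hinv : IsInvariantProb (shift (1 : Γ)) (wordSubshift Γ (H.toeplitz y))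
      (H.haar.map (coding c y)) := by
    refine ⟨Measure.isProbabilityMeasure_map hmeas.aemeasurable, ⟨hshift, ?_⟩, ?_⟩
    · rw [Measure.map_map hshift hmeas]
      have : shift (1 : Γ) ∘ coding c y = coding c y ∘ H.tau := funext (shift_coding hc)
      rw [this, ← Measure.map_map hmeas measurePreserving_tau.measurable, measurePreserving_tau.map_eq]
    · rw [Measure.map_apply hmeas (isClosed_wordSubshift _).measurableSet.compl]
      convert measure_empty (μ := H.haar)
      ext g
      simpa using coding_mem hH hy hc g
  refine ⟨⟨isMinimalSystem_wordSubshift hH y hne, _, hinv, fun ν hν => hy.measure_eq hH hν hinv⟩,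
    hy.coverEntropy_eq_zero hH hne, _, hinv, ?_⟩
  obtain ⟨φ, hφ, hφc⟩ := hemb.exists_measurable_extend measurable_id fun _ => ⟨0⟩
  have hφc (g) : φ (coding c y g) = g := congrFun hφc g
  refine ⟨φ, coding c y, ⟨hφ, ?_⟩, hpres, ?_, .of_forall hφc, ?_⟩
  · rw [Measure.map_map hφ hmeas]
    rw [show φ ∘ coding c y = id from funext hφc, Measure.map_id]
  · exact hemb.ae_map_iff.2 (.of_forall fun g => by rw [hφc])
  · exact hemb.ae_map_iff.2 (.of_forall fun g => by rw [shift_coding hc, hφc, hφc])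

end Scale

/-! ### The full one-sided shift -/

lemma coverEntropy_fullShift_pos :
    0 < Dynamics.coverEntropy (shift (1 : ℕ)) (Set.univ : Set (ℕ → Bool)) := by
  classical
  let U : SetRel (ℕ → Bool) (ℕ → Bool) := {z | z.1 0 = z.2 0}
  have hU : U ∈ 𝓤 (ℕ → Bool) := by
    have h : {b : Bool × Bool | b.1 = b.2} ∈ 𝓤 Bool := DiscreteUniformity.relId_mem_uniformity Bool
    exact Pi.uniformContinuous_proj (fun _ : ℕ => Bool) 0 h
  refine lt_of_lt_of_le ?_ (Dynamics.netEntropyEntourage_le_coverEntropy _ _ hU)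
  refine lt_of_lt_of_le (?_ : 0 < ENNReal.log 2) ?_
  · rw [ENNReal.zero_lt_log_iff]
    exact ENNReal.one_lt_two
  rw [Dynamics.netEntropyEntourage, ← ExpGrowth.expGrowthSup_pow]
  refine ExpGrowth.expGrowthSup_monotone fun n => ?_
  -- The words of length `n`, continued by `false`, form a net.
  let e : (Fin n → Bool) → ℕ → Bool := fun w k => if h : k < n then w ⟨k, h⟩ else false
  have he (w : Fin n → Bool) (k : Fin n) : e w k = w k := by simp [e]
  have hinj : Function.Injective e := fun w w' h => funext fun k => by
    rw [← he w, ← he w', h]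
  have hnet : Dynamics.IsDynNetIn (shift (1 : ℕ)) Set.univ U n
      ((Finset.univ.map ⟨e, hinj⟩ : Finset (ℕ → Bool)) : Set (ℕ → Bool)) := by
    refine ⟨Set.subset_univ _, ?_⟩
    intro z hz z' hz' hne
    simp only [Finset.coe_map, Finset.coe_univ, Set.image_univ, Set.mem_range,
      Function.Embedding.coeFn_mk] at hz hz'
    obtain ⟨w, rfl⟩ := hz
    obtain ⟨w', rfl⟩ := hz'
    refine Set.disjoint_left.2 fun v hv hv' => hne (congrArg e (funext fun k => ?_))
    have h1 : (shift (1 : ℕ))^[k] (e w) 0 = (shift (1 : ℕ))^[k] v 0 :=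
      Dynamics.mem_dynEntourage.1 hv k k.2
    have h2 : (shift (1 : ℕ))^[k] (e w') 0 = (shift (1 : ℕ))^[k] v 0 :=
      Dynamics.mem_dynEntourage.1 hv' k k.2
    rw [iterate_shift_apply] at h1 h2
    rw [← he w, ← he w']
    exact h1.trans h2.symm
  refine le_trans (le_of_eq ?_) (ENat.toENNReal_mono hnet.card_le_netMaxcard)
  simp

/-- The itinerary of a point of the circle under the doubling map, with respect to the arc of
radius `ε` around `0`. -/
noncomputable def doublingCoding (ε : ℝ) (t : UnitAddCircle) (n : ℕ) : Bool :=
  open Classical in decide ((2 ^ n) • t ∈ Metric.closedBall (0 : UnitAddCircle) ε)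

lemma measurable_doublingCoding (ε : ℝ) : Measurable (doublingCoding ε) := by
  refine measurable_pi_lambda _ fun n => measurable_to_bool ?_
  have : (fun t => doublingCoding ε t n) ⁻¹' {true} =
      (fun t : UnitAddCircle => (2 ^ n) • t) ⁻¹' Metric.closedBall 0 ε := by
    ext t
    simp [doublingCoding]
  rw [this]
  exact (continuous_const_smul (2 ^ n)).measurable Metric.isClosed_closedBall.measurableSet

/-- The doubling map is ergodic, hence so are the distributions of its codings by arcs; arcs of
different lengths give different measures. -/
lemma not_countable_ergodic_measures :
    ¬ {μ : Measure (ℕ → Bool) | IsInvariantProb (shift (1 : ℕ)) Set.univ μ ∧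
      Ergodic (shift (1 : ℕ)) μ}.Countable := by
  intro hcount
  let m : ℝ → Measure (ℕ → Bool) := fun ε => volume.map (doublingCoding ε)
  have hmem (ε : ℝ) : m ε ∈ {μ : Measure (ℕ → Bool) |
      IsInvariantProb (shift (1 : ℕ)) Set.univ μ ∧ Ergodic (shift (1 : ℕ)) μ} := by
    have hmeas := measurable_doublingCoding ε
    have hshift : Measurable (shift (1 : ℕ) : (ℕ → Bool) → ℕ → Bool) :=
      measurable_pi_lambda _ fun t => measurable_pi_apply _
    have herg : Ergodic (shift (1 : ℕ)) (m ε) := by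
      refine MeasurePreserving.ergodic_of_ergodic_semiconj ⟨hmeas, rfl⟩
        (AddCircle.ergodic_nsmul one_lt_two) hshift fun t => funext fun n => ?_
      rw [shift_apply, doublingCoding, doublingCoding, add_comm 1 n, pow_succ, mul_smul]
    have : IsProbabilityMeasure (volume : Measure UnitAddCircle) := ⟨UnitAddCircle.measure_univ⟩
    exact ⟨⟨Measure.isProbabilityMeasure_map hmeas.aemeasurable, herg.toMeasurePreserving,
      by simp⟩, herg⟩
  have hval (ε : ℝ) : m ε {z | z 0 = true} = ENNReal.ofReal (min 1 (2 * ε)) := by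
    have hset : MeasurableSet {z : ℕ → Bool | z 0 = true} :=
      (measurable_pi_apply 0 : Measurable fun z : ℕ → Bool => z 0) (measurableSet_singleton true)
    rw [Measure.map_apply (measurable_doublingCoding ε) hset,
      ← AddCircle.volume_closedBall (T := 1) (x := 0)]
    congr 1
    ext t
    simp [doublingCoding]
  have hinj : Set.InjOn m (Set.Ioo 0 (1 / 2)) := by
    rintro ε ⟨hε0, hε⟩ δ ⟨hδ0, hδ⟩ h
    have h1 := hval ε
    rw [h, hval δ, min_eq_right (by linarith), min_eq_right (by linarith),
      ENNReal.ofReal_eq_ofReal_iff (by linarith) (by linarith)] at h1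
    linarith
  have hIoo : (Set.Ioo (0 : ℝ) (1 / 2)).Countable :=
    Set.countable_of_injective_of_countable_image hinj
      (hcount.mono (by rintro _ ⟨ε, -, rfl⟩; exact hmem ε))
  rw [← Cardinal.le_aleph0_iff_set_countable, Cardinal.mk_Ioo_real (by norm_num)] at hIoo
  exact absurd hIoo (not_le.2 Cardinal.aleph0_lt_continuum)

/-- `y` is a one-sided 0-1 sequence, `Y` is its orbit closure, and `X_y` is the orbit closure of
`x_y`; the assertions on `X_y` are made for the unilateral and for the bilateral subshift. -/
theorem mainTheorem9 (H : Scale) (hH : 3 ≤ H.p 0) :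
    ∃ y : ℕ → Bool,
      -- the orbit closure of `y` has positive topological entropy
      0 < Dynamics.coverEntropy (shift (1 : ℕ)) (orbitClosure y) ∧
      -- and supports uncountably many ergodic invariant measures
      ¬ {μ : Measure (ℕ → Bool) | IsInvariantProb (shift (1 : ℕ)) (orbitClosure y) μ ∧
          Ergodic (shift (1 : ℕ)) μ}.Countable ∧
      -- the unilateral subshift
      (IsStrictlyErgodic (shift (1 : ℕ)) (orbitClosure (H.toeplitz y)) ∧
        Dynamics.coverEntropy (shift (1 : ℕ)) (orbitClosure (H.toeplitz y)) = 0 ∧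
        ∃ μ : Measure (ℕ → Bool),
          IsInvariantProb (shift (1 : ℕ)) (orbitClosure (H.toeplitz y)) μ ∧
          MeasureIsomorphic (shift (1 : ℕ)) μ H.tau H.haar) ∧
      -- the bilateral subshift
      (IsStrictlyErgodic (shift (1 : ℤ)) (bilateralSubshift (H.toeplitz y)) ∧
        Dynamics.coverEntropy (shift (1 : ℤ)) (bilateralSubshift (H.toeplitz y)) = 0 ∧
        ∃ μ : Measure (ℤ → Bool),
          IsInvariantProb (shift (1 : ℤ)) (bilateralSubshift (H.toeplitz y)) μ ∧
          MeasureIsomorphic (shift (1 : ℤ)) μ H.tau H.haar) := by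
  obtain ⟨y, hy⟩ := Scale.exists_admissible hH
  refine ⟨y, ?_, ?_, ?_, ?_⟩
  · rw [hy.orbitClosure_eq_univ]
    exact coverEntropy_fullShift_pos
  · rw [hy.orbitClosure_eq_univ]
    exact not_countable_ergodic_measures
  · rw [orbitClosure_eq]
    exact hy.strictlyErgodic_and_isomorphic hH (c := multiplesHom _ H.generator) (by simp)
  · rw [bilateralSubshift_eq]
    exact hy.strictlyErgodic_and_isomorphic hH (c := zmultiplesHom _ H.generator) (by simp)
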